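/- Let $d,s$ be integers with $2\le s\le d$, and let $\sigma(t)=\max\{t,0\}$, applied componentwise to vectors. A filter is a real sequence $w=(w_k)_{k\in\mathbb Z}$ supported on $\{0,1,\dots,s\}$; for $v\in\mathbb R^{m}$ the zero-padded convolution $w*v\in\mathbb R^{m+s}$ is $$(w*v)_j=\sum_{k=1}^{m}w_{j-k}v_k,\qquad j=1,\dots,m+s .$$ For integers $m,n,\ell\ge1$, a block of depth $\ell$ from $\mathbb R^m$ to $\mathbb R^n$ is given by filters $w^1,\dots,w^\ell$, scalars $b^1,\dots,b^{\ell-1}$ and a vector $\vec b\in\mathbb R^{m+\ell s}$. It maps $x\in\mathbb R^m$ as follows: put $v^0=x$, $v^i=\sigma(w^i*v^{i-1}+b^i\mathbf 1)\in\mathbb R^{m+is}$ for $1\le i\le \ell-1$, and $v^\ell=\sigma(w^\ell*v^{\ell-1}+\vec b)\in\mathbb R^{m+\ell s}$; the output is the location-based pooling of $v^\ell$ with scaling parameter $m$ and location parameter $0$, that is, the vector $\big((v^\ell)_{km}\big)_{k=1}^{n}$, where entries with $km>m+\ell s$ are read as $0$. Let $$\ell_1=\Big\lceil\frac{d(d+1)}{s-1}\Big\rceil,\qquad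 \ell_j=\Big\lceil\frac{(d+1)^2}{s-1}\Big\rceil\quad(j\ge2).$$ For $L\ge1$ let $\mathcal H_L$ be the set of all functions $x\mapsto \vec a\cdot (V_L\circ\cdots\circ V_1)(x)$ on $[0,1]^d$, where $\vec a\in\mathbb R^{d+1}$, $V_1$ is a block of depth $\ell_1$ from $\mathbb R^d$ to $\mathbb R^{d+1}$, and, for $2\le j\le L$, $V_j$ is a block of depth $\ell_j$ from $\mathbb R^{d+1}$ to $\mathbb R^{d+1}$. Then for every $\varepsilon>0$ and every continuous $f:[0,1]^d\to\mathbb R$ there is an integer $L\ge1$ such that $$\operatorname{dist}(f,\mathcal H_L):=\inf_{g\in\mathcal H_L}\ \max_{x\in[0,1]^d}|f(x)-g(x)|<\varepsilon .$$ -/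

import Mathlib

namespace EDCNN

/-- The unit cube `[0,1]^d`. -/
abbrev Cube (d : ℕ) : Type := Set.Icc (0 : Fin d → ℝ) 1

/-- Componentwise ReLU. -/
noncomputable def relu {n : ℕ} (x : Fin n → ℝ) : Fin n → ℝ := fun i => max (x i) 0

/-- A filter (a two-sided real sequence) supported on `{0, 1, …, s}`. -/
def IsFilter (s : ℕ) (w : ℤ → ℝ) : Prop := ∀ k : ℤ, w k ≠ 0 → 0 ≤ k ∧ k ≤ s

/-- The zero-padded (expansive) convolution `(w * v)_j = ∑_k w_{j-k} v_k`, from `ℝ^m` to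
`ℝ^{m+s}`. Coordinates are numbered from `0` instead of `1`, which leaves `j - k` unchanged. -/
def conv (s : ℕ) {m : ℕ} (w : ℤ → ℝ) (v : Fin m → ℝ) : Fin (m + s) → ℝ :=
  fun j => ∑ k : Fin m, w ((j : ℤ) - (k : ℤ)) * v k

/-- The layer widths of a block with input dimension `m`: `d_0 = m` and `d_ℓ = d_{ℓ-1} + s`. -/
def width (s m : ℕ) : ℕ → ℕ
  | 0 => m
  | l + 1 => width s m l + s

theorem width_eq (s m l : ℕ) : width s m l = m + l * s := by
  induction l with
  | zero => simp [width]
  | succ l ih => rw [width, ih]; ring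

/-- The restricted feature extractor with `ℓ` layers: the `i`-th layer (`1 ≤ i ≤ ℓ`) is
`v ↦ σ (w^i * v + b^i 𝟏)`, with one scalar bias per layer. -/
noncomputable def restrictedFeature (s m : ℕ) (w : ℕ → ℤ → ℝ) (b : ℕ → ℝ) :
    (l : ℕ) → (Fin m → ℝ) → Fin (width s m l) → ℝ
  | 0, x => x
  | l + 1, x => relu (conv s (w (l + 1)) (restrictedFeature s m w b l x) + fun _ => b (l + 1))

/-- Location-based pooling `v ↦ (v_{ku+j})_{k=1}^{⌊D/u⌋}` with scaling parameter `u` and location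
parameter `j`, where `v_i = 0` for `i > D`. The `1`-based index `ku+j` is the `0`-based index
`ku+j-1`. -/
noncomputable def pool {D : ℕ} (u j : ℕ) (v : Fin D → ℝ) : Fin (D / u) → ℝ :=
  fun k => if h : (k.val + 1) * u + j - 1 < D then v ⟨(k.val + 1) * u + j - 1, h⟩ else 0

/-- A vector regarded as an element of `ℝ^n`: the first `n` coordinates, with zeros where there
are none. -/
noncomputable def toDim {D : ℕ} (n : ℕ) (v : Fin D → ℝ) : Fin n → ℝ :=
  fun i => if h : i.val < D then v ⟨i.val, h⟩ else 0

/-- The free parameters of a block of depth `l ≥ 1` with input dimension `m`: filters `w^1, …, w^l`,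
scalar biases `b^1, …, b^{l-1}` and a bias vector for the last layer, which has width `m + l s`.
Entries of `filter` and `bias` with other indices are not used. -/
structure Block (s m l : ℕ) where
  filter : ℕ → ℤ → ℝ
  isFilter : ∀ i, IsFilter s (filter i)
  bias : ℕ → ℝ
  lastBias : Fin (width s m (l - 1) + s) → ℝ

/-- The feature map of a block of depth `l ≥ 1` with input dimension `m`: `l - 1` restricted layers,
then a convolutional layer with a full bias vector, then pooling with scaling parameter `m` and
location parameter `j`, regarded as a vector of `ℝ^n`. -/
noncomputable def Block.map {s m l : ℕ} (B : Block s m l) (n j : ℕ) (x : Fin m → ℝ) : Fin n → ℝ :=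
  toDim n (pool m j (relu
    (conv s (B.filter l) (restrictedFeature s m B.filter B.bias (l - 1) x) + B.lastBias)))

/-- The dimensions between the blocks: `d_0^* = d`, and `d_j^* = dstar j` for `j ≥ 1`. -/
def dims (d : ℕ) (dstar : ℕ → ℕ) : ℕ → ℕ
  | 0 => d
  | j + 1 => dstar (j + 1)

/-- The composition of the first `L` blocks, with pooling at location `0`. The block number `j + 1`
is `B j`; it has depth `depth (j + 1)` and maps `ℝ^{d_j^*}` to `ℝ^{d_{j+1}^*}`. -/
noncomputable def features (s d : ℕ) (dstar depth : ℕ → ℕ)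
    (B : (j : ℕ) → Block s (dims d dstar j) (depth (j + 1))) :
    (L : ℕ) → (Fin d → ℝ) → Fin (dims d dstar L) → ℝ
  | 0, x => x
  | L + 1, x => (B L).map (dims d dstar (L + 1)) 0 (features s d dstar depth B L x)

/-- The set of eDCNNs with `L` blocks of depths `depth 1, …, depth L`, dimensions
`d, dstar 1, …, dstar L` between them and pooling at location `0`, as functions on the cube:
all `x ↦ a · features(x)`. -/
def networks (s d : ℕ) (dstar depth : ℕ → ℕ) (L : ℕ) : Set C(Cube d, ℝ) :=
  {g | ∃ (B : (j : ℕ) → Block s (dims d dstar j) (depth (j + 1)))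
      (a : Fin (dims d dstar L) → ℝ),
      ∀ x : Cube d, g x = a ⬝ᵥ features s d dstar depth B L x.val}

end EDCNN

/-!
Convolution is multiplication of generating polynomials, and a real polynomial splits into factors
of degree at most `s` because its irreducible factors are at most quadratic. Scalar biases so large
that the intermediate ReLUs are inactive on a given compact set therefore turn a block of depth `l`
into one convolution with a long filter. If `n m ≤ l (s - 1)`, this filter can be chosen to hold all
rows of an `n × m` matrix, and pooling reads off an arbitrary fully connected ReLU layer.

Layers of width `d + 1` carry the input `x ≥ 0` along and update one further channel, so they
compute every iterated maximum and minimum of affine functions with arbitrarily many terms. These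
functions are dense: cut a compact set down by thin caps at points `p` of maximal Euclidean norm,
and add the caps back in reverse order, each time replacing `g` by
`max (f p + r) (min (f p - r) g)` with an affine `r` that is positive on the cap and very negative
away from `p`.
-/

namespace EDCNN

open Polynomial

theorem exists_dvd_natDegree_eq_or_eq_succ {P : ℝ[X]} (hP : P ≠ 0) {k : ℕ} (hk : k ≤ P.natDegree) :
    ∃ F, F ∣ P ∧ (F.natDegree = k ∨ F.natDegree = k + 1) := by
  induction k with
  | zero => exact ⟨1, one_dvd P, .inl natDegree_one⟩
  | succ k ih =>
    obtain ⟨F, ⟨G, rfl⟩, hF | hF⟩ := ih (by omega)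
    · obtain ⟨hF0, hG0⟩ := mul_ne_zero_iff.1 hP
      rw [natDegree_mul hF0 hG0] at hk
      have hGunit : ¬ IsUnit G := fun h => by
        have := natDegree_eq_zero_of_isUnit h
        omega
      obtain ⟨q, hq, hqG⟩ := WfDvdMonoid.exists_irreducible_factor hGunit hG0
      refine ⟨F * q, mul_dvd_mul_left F hqG, ?_⟩
      rw [natDegree_mul hF0 hq.ne_zero]
      have := hq.natDegree_le_two
      have := hq.natDegree_pos
      omega
    · exact ⟨F, Dvd.intro G rfl, .inl hF⟩

theorem exists_eq_mul_natDegree_le {P : ℝ[X]} {t n : ℕ} (hP : P.natDegree ≤ n + t) :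
    ∃ F G : ℝ[X], P = F * G ∧ F.natDegree ≤ t + 1 ∧ G.natDegree ≤ n := by
  rcases lt_or_ge P.natDegree t with ht | ht
  · exact ⟨P, 1, by simp, by omega, by simp⟩
  rcases eq_or_ne P 0 with rfl | hP0
  · exact ⟨0, 0, by simp⟩
  obtain ⟨F, ⟨G, rfl⟩, hF⟩ := exists_dvd_natDegree_eq_or_eq_succ hP0 ht
  obtain ⟨hF0, hG0⟩ := mul_ne_zero_iff.1 hP0
  rw [natDegree_mul hF0 hG0] at hP
  exact ⟨F, G, rfl, by omega, by omega⟩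

theorem exists_prod_range_eq_natDegree_le {P : ℝ[X]} {t q : ℕ}
    (hP : P.natDegree ≤ (q + 1) * t + 1) :
    ∃ F : ℕ → ℝ[X], (∀ i, (F i).natDegree ≤ t + 1) ∧ ∏ i ∈ Finset.range (q + 1), F i = P := by
  induction q generalizing P with
  | zero => exact ⟨fun _ => P, fun _ => hP.trans (by omega), by simp⟩
  | succ q ih =>
    obtain ⟨A, G, rfl, hA, hG⟩ :=
      exists_eq_mul_natDegree_le (t := t) (n := (q + 1) * t + 1) (hP.trans_eq (by ring))
    obtain ⟨F, hF, rfl⟩ := ih hG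
    refine ⟨fun | 0 => A | i + 1 => F i, fun | 0 => hA | i + 1 => hF i, ?_⟩
    rw [Finset.prod_range_succ', mul_comm]

/-- The coefficients of a polynomial as a two-sided sequence, which is a filter when the degree is
small; convolution with it is multiplication of generating polynomials. -/
noncomputable def coeffSeq (P : ℝ[X]) (k : ℤ) : ℝ := if 0 ≤ k then P.coeff k.toNat else 0

theorem isFilter_coeffSeq {s : ℕ} {P : ℝ[X]} (hP : P.natDegree ≤ s) : IsFilter s (coeffSeq P) := by
  intro k hk
  obtain ⟨hk0, hcoeff⟩ : 0 ≤ k ∧ P.coeff k.toNat ≠ 0 := by simpa [coeffSeq] using hk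
  have := le_natDegree_of_ne_zero hcoeff
  omega

theorem coeffSeq_sub (P : ℝ[X]) (j k : ℕ) : coeffSeq P (j - k) = (P * X ^ k).coeff j := by
  rw [coeff_mul_X_pow', coeffSeq, Int.toNat_sub]
  simp only [sub_nonneg, Nat.cast_le]

theorem coeff_mul_ofFn (P : ℝ[X]) {m : ℕ} (v : Fin m → ℝ) (j : ℕ) :
    (P * ofFn m v).coeff j = ∑ k : Fin m, coeffSeq P (j - k) * v k := by
  simp only [ofFn_eq_sum_monomial, Finset.mul_sum, finsetSum_coeff, coeffSeq_sub,
    ← C_mul_X_pow_eq_monomial, mul_left_comm P, coeff_C_mul, mul_comm (v _)]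

theorem ofFn_conv_coeffSeq {s m : ℕ} {P : ℝ[X]} (hP : P.natDegree ≤ s) (v : Fin m → ℝ) :
    ofFn (m + s) (conv s (coeffSeq P) v) = P * ofFn m v := by
  ext j
  rw [coeff_mul_ofFn]
  rcases lt_or_ge j (m + s) with hj | hj
  · rw [ofFn_coeff_eq_val_of_lt _ hj, conv]
  · rw [ofFn_coeff_eq_zero_of_ge _ hj]
    refine (Finset.sum_eq_zero fun k _ => mul_eq_zero_of_left ?_ _).symm
    by_contra h
    have := isFilter_coeffSeq hP _ h
    omega

theorem conv_coeffSeq_apply {s m : ℕ} (P : ℝ[X]) (v : Fin m → ℝ) (j : Fin (m + s)) :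
    conv s (coeffSeq P) v j = (P * ofFn m v).coeff j :=
  (coeff_mul_ofFn P v j).symm

theorem continuous_relu {n : ℕ} : Continuous (relu (n := n)) := by
  unfold relu
  fun_prop

theorem continuous_conv (s m : ℕ) (w : ℤ → ℝ) : Continuous (conv s (m := m) w) := by
  unfold conv
  fun_prop

theorem continuous_restrictedFeature (s m : ℕ) (w : ℕ → ℤ → ℝ) (b : ℕ → ℝ) (l : ℕ) :
    Continuous (restrictedFeature s m w b l) := by
  induction l with
  | zero => exact continuous_id
  | succ l ih =>
    exact continuous_relu.comp (((continuous_conv s _ _).comp ih).add continuous_const)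

theorem continuous_toDim_pool {D : ℕ} (n u j : ℕ) :
    Continuous fun v : Fin D → ℝ => toDim n (pool u j v) := by
  refine continuous_pi fun i => ?_
  unfold toDim pool
  split_ifs <;> fun_prop

theorem Block.continuous_map {s m l : ℕ} (B : Block s m l) (n j : ℕ) : Continuous (B.map n j) :=
  (continuous_toDim_pool n m j).comp <| continuous_relu.comp <|
    ((continuous_conv s _ _).comp (continuous_restrictedFeature s m _ _ _)).add continuous_const

theorem restrictedFeature_congr_bias {s m : ℕ} {w : ℕ → ℤ → ℝ} {b b' : ℕ → ℝ} {l : ℕ}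
    (h : ∀ i ≤ l, b i = b' i) :
    restrictedFeature s m w b l = restrictedFeature s m w b' l := by
  induction l with
  | zero => rfl
  | succ l ih =>
    funext x
    rw [restrictedFeature, restrictedFeature, ih fun i hi => h i (by omega), h (l + 1) le_rfl]

theorem exists_relu_add_const_eq {n : ℕ} {S : Set (Fin n → ℝ)} (hS : Bornology.IsBounded S) :
    ∃ c : ℝ, ∀ u ∈ S, relu (u + fun _ => c) = u + fun _ => c := by
  obtain ⟨c, hc⟩ := hS.exists_norm_le
  refine ⟨c, fun u hu => funext fun i => max_eq_left ?_⟩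
  have : |u i| ≤ c := (norm_le_pi_norm u i).trans (hc u hu)
  simp only [Pi.add_apply]
  linarith [neg_le_of_abs_le this]

-- Large scalar biases keep every preactivation nonnegative on `K`, so the ReLUs act as identities.
theorem exists_bias_ofFn_restrictedFeature_eq {s m : ℕ} {K : Set (Fin m → ℝ)} (hK : IsCompact K)
    {F : ℕ → ℝ[X]} (hF : ∀ i, (F i).natDegree ≤ s) (l : ℕ) :
    ∃ (b : ℕ → ℝ) (Q : ℝ[X]), ∀ x ∈ K,
      ofFn (width s m l) (restrictedFeature s m (fun i => coeffSeq (F i)) b l x) =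
        (∏ i ∈ Finset.range l, F (i + 1)) * ofFn m x + Q := by
  induction l with
  | zero => exact ⟨0, 0, fun x _ => by
    rw [Finset.prod_range_zero, one_mul, add_zero]
    rfl⟩
  | succ l ih =>
    obtain ⟨b, Q, hbQ⟩ := ih
    set v := restrictedFeature s m (fun i => coeffSeq (F i)) b l
    have hv : Continuous v := continuous_restrictedFeature s m _ b l
    obtain ⟨c, hc⟩ := exists_relu_add_const_eq
      (S := (fun x => conv s (coeffSeq (F (l + 1))) (v x)) '' K)
      (hK.image ((continuous_conv s _ _).comp hv)).isBounded
    refine ⟨Function.update b (l + 1) c, F (l + 1) * Q + ofFn (width s m l + s) fun _ => c,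
      fun x hx => ?_⟩
    have hupdate : restrictedFeature s m (fun i => coeffSeq (F i)) (Function.update b (l + 1) c) l =
        v := restrictedFeature_congr_bias fun i hi => Function.update_of_ne (by omega) _ _
    rw [restrictedFeature, hupdate, Function.update_self]
    calc ofFn (width s m l + s) (relu (conv s (coeffSeq (F (l + 1))) (v x) + fun _ => c))
        = F (l + 1) * ofFn (width s m l) (v x) + ofFn (width s m l + s) fun _ => c := by
          rw [hc _ (Set.mem_image_of_mem _ hx), map_add, ofFn_conv_coeffSeq (hF _)]
      _ = (∏ i ∈ Finset.range (l + 1), F (i + 1)) * ofFn m x +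
            (F (l + 1) * Q + ofFn (width s m l + s) fun _ => c) := by
          rw [hbQ x hx, Finset.prod_range_succ]
          ring

theorem exists_filter_bias_conv_eq {s m l : ℕ} (hs : 1 ≤ s) {K : Set (Fin m → ℝ)}
    (hK : IsCompact K) {W : ℝ[X]} (hW : W.natDegree ≤ (l + 1) * (s - 1) + 1) :
    ∃ (w : ℕ → ℤ → ℝ) (b : ℕ → ℝ) (Q : ℝ[X]), (∀ i, IsFilter s (w i)) ∧
      ∀ x ∈ K, ∀ j, conv s (w (l + 1)) (restrictedFeature s m w b l x) j =
        (W * ofFn m x).coeff j + Q.coeff j := by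
  obtain ⟨F, hF, rfl⟩ := exists_prod_range_eq_natDegree_le hW
  rw [Nat.sub_add_cancel hs] at hF
  obtain ⟨b, Q, hbQ⟩ :=
    exists_bias_ofFn_restrictedFeature_eq hK (F := fun i => F (i - 1)) (fun i => hF _) l
  refine ⟨fun i => coeffSeq (F (i - 1)), b, F l * Q, fun i => isFilter_coeffSeq (hF _),
    fun x hx j => ?_⟩
  rw [conv_coeffSeq_apply, hbQ x hx, ← coeff_add, Finset.prod_range_succ]
  simp only [Nat.add_sub_cancel]
  ring_nf

/-- The polynomial whose product with the generating polynomial of `x` has the entries of `A *ᵥ x`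
among its coefficients: its coefficients are the rows of `A`, each of them reversed. -/
noncomputable def rowPoly {n m : ℕ} (A : Matrix (Fin n) (Fin m) ℝ) : ℝ[X] :=
  ofFn (n * m) fun i => A i.divNat i.modNat.rev

theorem coeffSeq_rowPoly {n m : ℕ} (A : Matrix (Fin n) (Fin m) ℝ) (k : Fin n) (j : Fin m) :
    coeffSeq (rowPoly A) (((k + 1) * m - 1 : ℕ) - j) = A k j := by
  set i : Fin (n * m) := finProdFinEquiv (k, j.rev) with hi
  have hval : (((k + 1) * m - 1 : ℕ) - j : ℤ) = (i : ℕ) := by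
    have h1 : (k + 1 : ℕ) * m = m * k + m := by ring
    simp only [hi, finProdFinEquiv_apply_val, Fin.val_rev]
    omega
  have hdivMod : (i.divNat, i.modNat) = (k, j.rev) := finProdFinEquiv.symm_apply_apply _
  have hdiv : i.divNat = k := congrArg Prod.fst hdivMod
  have hmod : i.modNat = j.rev := congrArg Prod.snd hdivMod
  rw [hval, coeffSeq, if_pos (Int.natCast_nonneg _), Int.toNat_natCast, rowPoly,
    ofFn_coeff_eq_val_of_lt _ i.isLt, Fin.eta, hdiv, hmod, Fin.rev_rev]

theorem coeff_rowPoly_mul_ofFn {n m : ℕ} (A : Matrix (Fin n) (Fin m) ℝ) (x : Fin m → ℝ)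
    (k : Fin n) : (rowPoly A * ofFn m x).coeff ((k + 1) * m - 1) = A.mulVec x k := by
  simp only [coeff_mul_ofFn, coeffSeq_rowPoly, Matrix.mulVec, dotProduct]

/-- The `0`-based position that pooling with scaling parameter `m` reads for the output `k`. -/
def poolIndex {n m D : ℕ} (hm : 0 < m) (hD : n * m ≤ D) (k : Fin n) : Fin D :=
  ⟨(k + 1) * m - 1, by
    have : (k + 1 : ℕ) * m ≤ n * m := Nat.mul_le_mul_right m k.isLt
    have : 0 < (k + 1 : ℕ) * m := Nat.mul_pos k.val.succ_pos hm
    omega⟩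

theorem poolIndex_injective {n m D : ℕ} (hm : 0 < m) (hD : n * m ≤ D) :
    Function.Injective (poolIndex hm hD) := by
  intro k k' h
  have h1 : 0 < (k + 1 : ℕ) * m := Nat.mul_pos k.val.succ_pos hm
  have h2 : 0 < (k' + 1 : ℕ) * m := Nat.mul_pos k'.val.succ_pos hm
  have h3 : (k + 1 : ℕ) * m - 1 = (k' + 1) * m - 1 := congrArg Fin.val h
  have h4 : (k + 1 : ℕ) = k' + 1 := Nat.eq_of_mul_eq_mul_right hm (by omega)
  omega

theorem toDim_pool_eq {n m D : ℕ} (hm : 0 < m) (hD : n * m ≤ D) (v : Fin D → ℝ) :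
    toDim n (pool m 0 v) = v ∘ poolIndex hm hD := by
  funext k
  have hk : (k : ℕ) < D / m := k.isLt.trans_le ((Nat.le_div_iff_mul_le hm).2 hD)
  simp only [toDim, pool, dif_pos hk, add_zero]
  exact dif_pos (poolIndex hm hD k).isLt

-- The entries of `A *ᵥ x` sit at the pooled positions of the last convolution, where the vector
-- bias of the last layer absorbs the offset left by the scalar biases.
theorem exists_block_map_eq {s m n l : ℕ} (hm : 0 < m) (hn : 0 < n)
    (hl : n * m ≤ l * (s - 1)) {K : Set (Fin m → ℝ)} (hK : IsCompact K)
    (A : Matrix (Fin n) (Fin m) ℝ) (β : Fin n → ℝ) :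
    ∃ B : Block s m l, ∀ x ∈ K, B.map n 0 x = relu (A.mulVec x + β) := by
  have hnm : 0 < n * m := Nat.mul_pos hn hm
  obtain ⟨hl0, hs0⟩ : 0 < l ∧ 0 < s - 1 := CanonicallyOrderedAdd.mul_pos.1 (hnm.trans_le hl)
  obtain ⟨l, rfl⟩ : ∃ l', l = l' + 1 := Nat.exists_eq_succ_of_ne_zero hl0.ne'
  have hA : (rowPoly A).natDegree < n * m := ofFn_natDegree_lt hnm _
  obtain ⟨w, b, Q, hw, hconv⟩ :=
    exists_filter_bias_conv_eq (s := s) (l := l) (by omega) hK (W := rowPoly A) (by omega)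
  have hD : n * m ≤ width s m l + s := by
    have h1 : (l + 1) * (s - 1) ≤ (l + 1) * s := Nat.mul_le_mul_left _ (by omega)
    have h2 : width s m l + s = m + (l + 1) * s := width_eq s m (l + 1)
    omega
  have hinj := poolIndex_injective hm hD
  refine ⟨⟨w, hw, b, fun j => Function.extend (poolIndex hm hD) β 0 j - Q.coeff j⟩,
    fun x hx => ?_⟩
  rw [Block.map, toDim_pool_eq hm hD]
  funext k
  have hpre : conv s (w (l + 1)) (restrictedFeature s m w b l x) (poolIndex hm hD k) =
      A.mulVec x k + Q.coeff (poolIndex hm hD k) :=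
    (hconv x hx _).trans (congrArg (· + _) (coeff_rowPoly_mul_ofFn A x k))
  refine (congrArg (fun y => max (y + _) 0) hpre).trans ?_
  simp only [hinj.extend_apply, add_add_sub_cancel, relu, Pi.add_apply]

section MaxMinString

/-- Functions obtained from an affine function by repeatedly taking the maximum or the minimum with
an affine function. A ReLU network that carries its input along computes them with one additional
channel, and they approximate every continuous function. -/
inductive IsMaxMinString {E : Type*} [AddCommGroup E] [Module ℝ E] [TopologicalSpace E] :
    (E → ℝ) → Prop
  | affine (a : E →L[ℝ] ℝ) (c : ℝ) : IsMaxMinString fun x => a x + c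
  | max (a : E →L[ℝ] ℝ) (c : ℝ) {g : E → ℝ} (hg : IsMaxMinString g) :
      IsMaxMinString fun x => max (a x + c) (g x)
  | min (a : E →L[ℝ] ℝ) (c : ℝ) {g : E → ℝ} (hg : IsMaxMinString g) :
      IsMaxMinString fun x => min (a x + c) (g x)

namespace IsMaxMinString

variable {E F : Type*} [AddCommGroup E] [Module ℝ E] [TopologicalSpace E]
  [AddCommGroup F] [Module ℝ F] [TopologicalSpace F] {g : E → ℝ}

theorem continuous (hg : IsMaxMinString g) : Continuous g := by
  induction hg with
  | affine a c => fun_prop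
  | max a c _ ih => fun_prop
  | min a c _ ih => fun_prop

theorem comp_continuousLinearMap (hg : IsMaxMinString g) (T : F →L[ℝ] E) :
    IsMaxMinString (g ∘ T) := by
  induction hg with
  | affine a c => exact affine (a.comp T) c
  | max a c _ ih => exact ih.max (a.comp T) c
  | min a c _ ih => exact ih.min (a.comp T) c

end IsMaxMinString

open RealInnerProductSpace

variable {E : Type*} [NormedAddCommGroup E] [InnerProductSpace ℝ E]

theorem norm_sub_sq_le_of_norm_le {p x : E} (h : ‖x‖ ≤ ‖p‖) :
    ‖p - x‖ ^ 2 ≤ 2 * (⟪p, p⟫ - ⟪p, x⟫) := by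
  have := pow_le_pow_left₀ (norm_nonneg x) h 2
  rw [norm_sub_sq_real, real_inner_self_eq_norm_sq]
  linarith

-- Every cut removes a whole ball of a fixed finite cover of `K₀`, so finitely many cuts suffice.
theorem compact_induction_cap {K₀ : Set E} (hK₀ : IsCompact K₀) {κ : ℝ} (hκ : 0 < κ)
    {P : Set E → Prop} (empty : P ∅)
    (cap : ∀ K ⊆ K₀, ∀ p ∈ K, (∀ x ∈ K, ‖x‖ ≤ ‖p‖) →
      P (K ∩ {x | ⟪p, x⟫ ≤ ⟪p, p⟫ - κ}) → P K) :
    P K₀ := by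
  classical
  obtain ⟨R, hR, hK₀R⟩ := hK₀.isBounded.exists_pos_norm_le
  set r := κ / (2 * R) with hr
  obtain ⟨t, -, ht, hK₀t⟩ := hK₀.finite_cover_balls (e := r) (by positivity)
  suffices h : ∀ (t : Finset E) (K : Set E), K ⊆ K₀ → IsClosed K →
      K ⊆ ⋃ z ∈ t, Metric.ball z r → P K from
    h ht.toFinset K₀ subset_rfl hK₀.isClosed (by simpa using hK₀t)
  intro t
  induction t using Finset.strongInduction with
  | H t ih =>
  intro K hKK₀ hK hKt
  rcases K.eq_empty_or_nonempty with rfl | hne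
  · exact empty
  obtain ⟨p, hpK, hpmax⟩ := (hK₀.of_isClosed_subset hK hKK₀).exists_isMaxOn hne
    continuous_norm.continuousOn
  obtain ⟨z, hzt, hpz⟩ := Set.mem_iUnion₂.1 (hKt hpK)
  have hball : ∀ y ∈ Metric.ball z r, ⟪p, p⟫ - κ < ⟪p, y⟫ := fun y hy => by
    have hdist : ‖p - y‖ < 2 * r := by
      rw [← dist_eq_norm]
      linarith [dist_triangle_right p y z, Metric.mem_ball.1 hpz, Metric.mem_ball.1 hy]
    have : ⟪p, p⟫ - ⟪p, y⟫ < κ := calc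
      ⟪p, p⟫ - ⟪p, y⟫ = ⟪p, p - y⟫ := (inner_sub_right p p y).symm
      _ ≤ ‖p‖ * ‖p - y‖ := real_inner_le_norm p (p - y)
      _ ≤ R * ‖p - y‖ := by gcongr; exact hK₀R p (hKK₀ hpK)
      _ < R * (2 * r) := by gcongr
      _ = κ := by rw [hr]; field_simp
    linarith
  refine cap K hKK₀ p hpK hpmax (ih (t.erase z) (Finset.erase_ssubset hzt) _
    (Set.inter_subset_left.trans hKK₀)
    (hK.inter (isClosed_le (by fun_prop) continuous_const)) fun y hy => ?_)
  obtain ⟨z', hz't, hyz'⟩ := Set.mem_iUnion₂.1 (hKt hy.1)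
  refine Set.mem_iUnion₂.2 ⟨z', Finset.mem_erase.2 ⟨?_, hz't⟩, hyz'⟩
  rintro rfl
  exact (hball y hyz').not_ge hy.2

theorem abs_max_min_sub_le {ε M r t u y : ℝ} (hM : |u - y| ≤ M) (hr : r ≤ ε / 2)
    (hnear : -M < r → |u - y| ≤ ε / 2) (ht : r ≤ 0 → |t - y| ≤ ε) :
    |max (u + r) (min (u - r) t) - y| ≤ ε := by
  rcases le_or_gt r 0 with hr0 | hr0
  · obtain ⟨hty, hyt⟩ := abs_le.1 (ht hr0)
    obtain ⟨hupper, hlower⟩ : u + r ≤ y + ε ∧ y - ε ≤ u - r := by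
      rcases lt_or_ge (-M) r with hMr | hMr
      · have := abs_le.1 (hnear hMr)
        constructor <;> linarith
      · have := abs_le.1 hM
        constructor <;> linarith
    rw [abs_sub_le_iff, sub_le_iff_le_add', sub_le_comm]
    exact ⟨max_le hupper ((min_le_right _ _).trans (by linarith)),
      (le_min hlower (by linarith)).trans (le_max_right _ _)⟩
  · have hnear := abs_le.1 (hnear (by linarith [(abs_nonneg (u - y)).trans hM]))
    rw [max_eq_left ((min_le_left _ _).trans (by linarith)), abs_le]
    constructor <;> linarith

-- The witness is `max (f p + r) (min (f p - r) g)` with `r` affine, equal to `ε / 2` at `p` and to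
-- `0` on the boundary of the cap: where `0 < r` it is `f p + r`, where `-M < r ≤ 0` the point is
-- still `δ`-close to `p`, and where `r ≤ -M` truncating `g` by `f p ± r` does not spoil it.
theorem IsMaxMinString.exists_extend_cap {f g : E → ℝ} (hg : IsMaxMinString g) {K : Set E} {p : E}
    (hpmax : ∀ x ∈ K, ‖x‖ ≤ ‖p‖) {ε δ κ M : ℝ} (hε : 0 < ε) (hκ : 0 < κ) (hδ : 0 ≤ δ)
    (hκδ : 2 * (κ * (1 + 2 * M / ε)) ≤ δ ^ 2) (hM : ∀ x ∈ K, |f p - f x| ≤ M)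
    (hfδ : ∀ x ∈ K, dist p x ≤ δ → |f p - f x| ≤ ε / 2)
    (hgf : ∀ x ∈ K ∩ {x | ⟪p, x⟫ ≤ ⟪p, p⟫ - κ}, |g x - f x| ≤ ε) :
    ∃ g' : E → ℝ, IsMaxMinString g' ∧ ∀ x ∈ K, |g' x - f x| ≤ ε := by
  set α := ε / (2 * κ) with hα
  have hα0 : 0 < α := by positivity
  refine ⟨_, .max (α • innerSL ℝ p) (f p - α * (⟪p, p⟫ - κ))
    (.min (-(α • innerSL ℝ p)) (f p + α * (⟪p, p⟫ - κ)) hg), fun x hx => ?_⟩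
  set r := α * (⟪p, x⟫ - (⟪p, p⟫ - κ)) with hr
  have hupper : (α • innerSL ℝ p) x + (f p - α * (⟪p, p⟫ - κ)) = f p + r := by
    simp only [hr, smul_apply, innerSL_apply_apply, smul_eq_mul]
    ring
  have hlower : (-(α • innerSL ℝ p)) x + (f p + α * (⟪p, p⟫ - κ)) = f p - r := by
    simp only [hr, neg_apply, smul_apply, innerSL_apply_apply, smul_eq_mul]
    ring
  have hdist : ‖p - x‖ ^ 2 ≤ 2 * (⟪p, p⟫ - ⟪p, x⟫) := norm_sub_sq_le_of_norm_le (hpmax x hx)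
  rw [hupper, hlower]
  refine abs_max_min_sub_le (hM x hx) ?_ (fun hMr => hfδ x hx ?_) fun hr0 => hgf x ⟨hx, ?_⟩
  · calc r ≤ α * κ := by
          rw [hr]
          gcongr
          linarith [sq_nonneg ‖p - x‖]
      _ = ε / 2 := by rw [hα]; field_simp
  · have hMα : M = α * (κ * (2 * M / ε)) := by rw [hα]; field_simp
    have hdepth : ⟪p, p⟫ - ⟪p, x⟫ < κ * (1 + 2 * M / ε) := by
      rw [hMα, hr, ← mul_neg, mul_lt_mul_iff_right₀ hα0] at hMr
      linarith
    rw [dist_eq_norm]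
    exact le_of_sq_le_sq (by linarith) hδ
  · have := nonpos_of_mul_nonpos_right hr0 hα0
    simp only [Set.mem_ofPred_eq]
    linarith

theorem exists_isMaxMinString_abs_sub_le_of_innerProductSpace {K : Set E} (hK : IsCompact K)
    {f : E → ℝ} (hf : ContinuousOn f K) {ε : ℝ} (hε : 0 < ε) :
    ∃ g : E → ℝ, IsMaxMinString g ∧ ∀ x ∈ K, |g x - f x| ≤ ε := by
  obtain ⟨δ, hδ, hfδ⟩ := Metric.uniformContinuousOn_iff_le.1
    (hK.uniformContinuousOn_of_continuous hf) (ε / 2) (half_pos hε)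
  set M := Metric.diam (f '' K)
  have hM0 : 0 ≤ M := Metric.diam_nonneg
  have hfM : ∀ x ∈ K, ∀ y ∈ K, |f x - f y| ≤ M := fun x hx y hy =>
    Metric.dist_le_diam_of_mem (hK.image_of_continuousOn hf).isBounded
      (Set.mem_image_of_mem f hx) (Set.mem_image_of_mem f hy)
  set κ := δ ^ 2 / (2 * (1 + 2 * M / ε)) with hκ
  have hκδ : 2 * (κ * (1 + 2 * M / ε)) = δ ^ 2 := by rw [hκ]; field_simp
  refine compact_induction_cap hK (κ := κ) (by positivity)
    (P := fun K' => ∃ g : E → ℝ, IsMaxMinString g ∧ ∀ x ∈ K', |g x - f x| ≤ ε)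
    ⟨_, .affine 0 0, fun x hx => absurd hx (Set.notMem_empty x)⟩
    fun K' hK' p hp hpmax ⟨g, hg, hgf⟩ => ?_
  exact hg.exists_extend_cap hpmax hε (by positivity) hδ.le hκδ.le
    (fun x hx => hfM p (hK' hp) x (hK' hx)) (fun x hx => hfδ p (hK' hp) x (hK' hx)) hgf

end MaxMinString

theorem exists_isMaxMinString_abs_sub_le {E : Type*} [AddCommGroup E] [Module ℝ E]
    [TopologicalSpace E] [IsTopologicalAddGroup E] [ContinuousSMul ℝ E] [T2Space E]
    [FiniteDimensional ℝ E] {K : Set E} (hK : IsCompact K) {f : E → ℝ} (hf : ContinuousOn f K)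
    {ε : ℝ} (hε : 0 < ε) :
    ∃ g : E → ℝ, IsMaxMinString g ∧ ∀ x ∈ K, |g x - f x| ≤ ε := by
  set T : E ≃L[ℝ] EuclideanSpace ℝ (Fin (Module.finrank ℝ E)) := toEuclidean
  have hfT : ContinuousOn (f ∘ T.symm) (T '' K) :=
    hf.comp T.symm.continuous.continuousOn (by simp [Set.MapsTo])
  obtain ⟨g, hg, hgf⟩ := exists_isMaxMinString_abs_sub_le_of_innerProductSpace
    (hK.image T.continuous) hfT hε
  refine ⟨g ∘ T, hg.comp_continuousLinearMap (T : E →L[ℝ] _), fun x hx => ?_⟩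
  simpa using hgf (T x) (Set.mem_image_of_mem T hx)

section FeatureMap

variable {s d : ℕ} {dstar depth : ℕ → ℕ}

theorem dims_pos (hd : 0 < d) (hdstar : ∀ j, d < dstar (j + 1)) : ∀ j, 0 < dims d dstar j
  | 0 => hd
  | j + 1 => hd.trans (hdstar j)

theorem features_congr {B B' : (j : ℕ) → Block s (dims d dstar j) (depth (j + 1))} {L : ℕ}
    (h : ∀ j < L, B j = B' j) :
    features s d dstar depth B L = features s d dstar depth B' L := by
  induction L with
  | zero => rfl
  | succ L ih =>
    funext x
    rw [features, features, ih fun j hj => h j (by omega), h L (by omega)]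

theorem continuous_features (B : (j : ℕ) → Block s (dims d dstar j) (depth (j + 1))) (L : ℕ) :
    Continuous (features s d dstar depth B L) := by
  induction L with
  | zero => exact continuous_id
  | succ L ih => exact ((B L).continuous_map _ 0).comp ih

theorem exists_features_succ_eq (hdims : ∀ j, 0 < dims d dstar j)
    (hdepth : ∀ j, dims d dstar (j + 1) * dims d dstar j ≤ depth (j + 1) * (s - 1))
    {K : Set (Fin d → ℝ)} (hK : IsCompact K)
    (B : (j : ℕ) → Block s (dims d dstar j) (depth (j + 1))) (L : ℕ)
    (T : (Fin (dims d dstar L) → ℝ) →ₗ[ℝ] (Fin (dims d dstar (L + 1)) → ℝ))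
    (β : Fin (dims d dstar (L + 1)) → ℝ) :
    ∃ B' : (j : ℕ) → Block s (dims d dstar j) (depth (j + 1)), ∀ x ∈ K,
      features s d dstar depth B' (L + 1) x = relu (T (features s d dstar depth B L x) + β) := by
  obtain ⟨V, hV⟩ := exists_block_map_eq (hdims L) (hdims (L + 1)) (hdepth L)
    (hK.image (continuous_features B L)) (LinearMap.toMatrix' T) β
  refine ⟨Function.update B L V, fun x hx => ?_⟩
  rw [features, Function.update_self,
    features_congr (B' := B) fun j hj => Function.update_of_ne hj.ne _ _,
    hV _ (Set.mem_image_of_mem _ hx), LinearMap.toMatrix'_mulVec]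

/-- On `K`, the map `φ` into a real vector space is a linear image of the features computed by some
`L` blocks; this is how expressiveness is tracked from block to block. Only linear images are
allowed, not affine ones, because networks have no output bias. -/
def IsFeatureMap (s d : ℕ) (dstar depth : ℕ → ℕ) (K : Set (Fin d → ℝ)) (L : ℕ) {F : Type*}
    [AddCommGroup F] [Module ℝ F] (φ : (Fin d → ℝ) → F) : Prop :=
  ∃ (B : (j : ℕ) → Block s (dims d dstar j) (depth (j + 1)))
    (T : (Fin (dims d dstar L) → ℝ) →ₗ[ℝ] F),
    ∀ x ∈ K, T (features s d dstar depth B L x) = φ x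

namespace IsFeatureMap

variable {K : Set (Fin d → ℝ)} {L : ℕ} {F G : Type*} [AddCommGroup F] [Module ℝ F]
  [AddCommGroup G] [Module ℝ G] {φ ψ : (Fin d → ℝ) → F}

theorem congr (hφ : IsFeatureMap s d dstar depth K L φ) (h : ∀ x ∈ K, φ x = ψ x) :
    IsFeatureMap s d dstar depth K L ψ := by
  obtain ⟨B, T, hT⟩ := hφ
  exact ⟨B, T, fun x hx => (hT x hx).trans (h x hx)⟩

theorem linearMap_comp (hφ : IsFeatureMap s d dstar depth K L φ) (A : F →ₗ[ℝ] G) :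
    IsFeatureMap s d dstar depth K L fun x => A (φ x) := by
  obtain ⟨B, T, hT⟩ := hφ
  exact ⟨B, A ∘ₗ T, fun x hx => congrArg A (hT x hx)⟩

theorem of_linearMap (A : (Fin d → ℝ) →ₗ[ℝ] F) : IsFeatureMap s d dstar depth K 0 A :=
  ⟨fun _ => ⟨0, fun _ _ h => absurd rfl h, 0, 0⟩, A, fun _ _ => rfl⟩

theorem posPart_comp {ι : Type*} [Fintype ι] (hdims : ∀ j, 0 < dims d dstar j)
    (hdepth : ∀ j, dims d dstar (j + 1) * dims d dstar j ≤ depth (j + 1) * (s - 1))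
    (hK : IsCompact K) (hφ : IsFeatureMap s d dstar depth K L φ)
    (hι : Fintype.card ι ≤ dims d dstar (L + 1)) (A : F →ₗ[ℝ] (ι → ℝ)) (β : ι → ℝ) :
    IsFeatureMap s d dstar depth K (L + 1) fun x => (A (φ x) + β)⁺ := by
  obtain ⟨B, T, hT⟩ := hφ
  obtain ⟨e⟩ : Nonempty (ι ↪ Fin (dims d dstar (L + 1))) :=
    Function.Embedding.nonempty_of_card_le (by simpa using hι)
  obtain ⟨B', hB'⟩ := exists_features_succ_eq hdims hdepth hK B L
    (Function.ExtendByZero.linearMap ℝ e ∘ₗ A ∘ₗ T) (Function.extend e β 0)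
  refine ⟨B', LinearMap.funLeft ℝ ℝ e, fun x hx => funext fun i => ?_⟩
  simp [hB' x hx, relu, hT x hx, LinearMap.funLeft_apply, e.injective.extend_apply, posPart_def]

-- The ReLU acts as the identity on the copy of the input carried along, which is nonnegative.
theorem prodMk_posPart (hd : 0 < d) (hdstar : ∀ j, d < dstar (j + 1))
    (hdepth : ∀ j, dims d dstar (j + 1) * dims d dstar j ≤ depth (j + 1) * (s - 1))
    (hK : IsCompact K) (hK0 : ∀ x ∈ K, 0 ≤ x) {v : (Fin d → ℝ) → ℝ}
    (hv : IsFeatureMap s d dstar depth K L fun x => (x, v x))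
    (a : (Fin d → ℝ) × ℝ →ₗ[ℝ] ℝ) (c : ℝ) :
    IsFeatureMap s d dstar depth K (L + 1) fun x => (x, (a (x, v x) + c)⁺) := by
  have hrelu := hv.posPart_comp (ι := Option (Fin d)) (dims_pos hd hdstar) hdepth hK
    (by simpa using! hdstar L)
    (LinearMap.pi fun o => o.elim a fun i => LinearMap.proj i ∘ₗ LinearMap.fst ℝ _ ℝ)
    (fun o => o.elim c 0)
  refine (hrelu.linearMap_comp
    ((LinearMap.funLeft ℝ ℝ some).prod (LinearMap.proj none))).congr fun x hx => ?_
  have hx0 : x⁺ = x := posPart_eq_self.2 (hK0 x hx)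
  refine Prod.ext (funext fun i => ?_) ?_
  · simpa [LinearMap.funLeft_apply] using! congrFun hx0 i
  · simp [LinearMap.pi_apply]

-- Networks have no output bias: one more block supplies `c` as a difference of two biased ReLUs.
theorem mem_networks (hd : 0 < d) (hdstar : ∀ j, d < dstar (j + 1))
    (hdepth : ∀ j, dims d dstar (j + 1) * dims d dstar j ≤ depth (j + 1) * (s - 1))
    (hφ : IsFeatureMap s d dstar depth (Set.Icc 0 1) L φ) {g : C(Cube d, ℝ)} (a : F →ₗ[ℝ] ℝ)
    (c : ℝ) (hg : ∀ x : Cube d, g x = a (φ x) + c) : g ∈ networks s d dstar depth (L + 1) := by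
  obtain ⟨B, T, hT⟩ := hφ.posPart_comp (ι := Fin 2) (dims_pos hd hdstar) hdepth isCompact_Icc
    (by simpa using! (Nat.succ_le_of_lt hd).trans_lt (hdstar L))
    (LinearMap.pi ![a, 0]) ![c + ‖g‖, ‖g‖]
  set S := LinearMap.proj 0 ∘ₗ T - LinearMap.proj 1 ∘ₗ T
  refine ⟨B, (dotProductEquiv ℝ _).symm S, fun x => ?_⟩
  have hgx : 0 ≤ a (φ x) + (c + ‖g‖) := by
    have := neg_le_of_abs_le (g.norm_coe_le_norm x)
    linarith [hg x]
  calc g x = (a (φ x) + (c + ‖g‖))⁺ - ‖g‖⁺ := by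
        rw [posPart_eq_self.2 hgx, posPart_eq_self.2 (norm_nonneg g), hg]
        ring
    _ = (a (φ x) + (c + ‖g‖))⁺ - (0 + ‖g‖)⁺ := by rw [zero_add]
    _ = S (features s d dstar depth B (L + 1) x) := by
        simp only [S, LinearMap.sub_apply, LinearMap.coe_comp, Function.comp_apply, hT x x.2]
        rfl
    _ = _ := (LinearMap.congr_fun ((dotProductEquiv ℝ _).apply_symm_apply S) _).symm

end IsFeatureMap

namespace IsMaxMinString

variable {g : (Fin d → ℝ) → ℝ}

theorem exists_isFeatureMap (hd : 0 < d) (hdstar : ∀ j, d < dstar (j + 1))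
    (hdepth : ∀ j, dims d dstar (j + 1) * dims d dstar j ≤ depth (j + 1) * (s - 1))
    {K : Set (Fin d → ℝ)} (hK : IsCompact K) (hK0 : ∀ x ∈ K, 0 ≤ x) (hg : IsMaxMinString g) :
    ∃ (L : ℕ) (v : (Fin d → ℝ) → ℝ) (a : (Fin d → ℝ) × ℝ →ₗ[ℝ] ℝ) (c : ℝ),
      IsFeatureMap s d dstar depth K L (fun x => (x, v x)) ∧ ∀ x, g x = a (x, v x) + c := by
  induction hg with
  | affine a c =>
    exact ⟨0, 0, (a : (Fin d → ℝ) →ₗ[ℝ] ℝ) ∘ₗ LinearMap.fst ℝ _ ℝ, c,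
      .of_linearMap (LinearMap.inl ℝ _ ℝ), fun x => rfl⟩
  | max a' c' _ ih =>
    obtain ⟨L, v, a, c, hv, hg⟩ := ih
    set a'' : (Fin d → ℝ) × ℝ →ₗ[ℝ] ℝ := (a' : (Fin d → ℝ) →ₗ[ℝ] ℝ) ∘ₗ LinearMap.fst ℝ _ ℝ
    refine ⟨L + 1, _, a'' + LinearMap.snd ℝ _ ℝ, c',
      hv.prodMk_posPart hd hdstar hdepth hK hK0 (a - a'') (c - c'), fun x => ?_⟩
    dsimp only
    rw [hg, max_comm, sup_eq_add_posPart_sub, add_sub_add_comm]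
    exact add_right_comm _ _ _
  | min a' c' _ ih =>
    obtain ⟨L, v, a, c, hv, hg⟩ := ih
    set a'' : (Fin d → ℝ) × ℝ →ₗ[ℝ] ℝ := (a' : (Fin d → ℝ) →ₗ[ℝ] ℝ) ∘ₗ LinearMap.fst ℝ _ ℝ
    refine ⟨L + 1, _, a'' - LinearMap.snd ℝ _ ℝ, c',
      hv.prodMk_posPart hd hdstar hdepth hK hK0 (a'' - a) (c' - c), fun x => ?_⟩
    dsimp only
    rw [hg, inf_eq_sub_posPart_sub, add_sub_add_comm]
    exact add_sub_right_comm _ _ _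

theorem exists_mem_networks (hd : 0 < d) (hdstar : ∀ j, d < dstar (j + 1))
    (hdepth : ∀ j, dims d dstar (j + 1) * dims d dstar j ≤ depth (j + 1) * (s - 1))
    (hg : IsMaxMinString g) :
    ∃ L, 1 ≤ L ∧ ContinuousMap.restrict (Set.Icc 0 1) ⟨g, hg.continuous⟩ ∈
      networks s d dstar depth L := by
  obtain ⟨L, v, a, c, hv, hgv⟩ :=
    hg.exists_isFeatureMap hd hdstar hdepth isCompact_Icc fun x hx => hx.1
  exact ⟨L + 1, by omega, hv.mem_networks hd hdstar hdepth a c fun x => hgv x⟩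

end IsMaxMinString

end FeatureMap

theorem le_natCeil_div_mul_sub_one {s : ℕ} (hs : 2 ≤ s) (N : ℕ) :
    N ≤ ⌈(N : ℝ) / ((s : ℝ) - 1)⌉₊ * (s - 1) := by
  have hs0 : (0 : ℝ) < ((s - 1 : ℕ) : ℝ) := by exact_mod_cast Nat.sub_pos_of_lt hs
  rw [← Nat.cast_pred (by omega), ← Nat.cast_le (α := ℝ), Nat.cast_mul, ← div_le_iff₀ hs0]
  exact Nat.le_ceil _

theorem dims_mul_dims_le {d s : ℕ} (hs : 2 ≤ s) {ℓ : ℕ → ℕ}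
    (hℓ₁ : ℓ 1 = ⌈(d : ℝ) * ((d : ℝ) + 1) / ((s : ℝ) - 1)⌉₊)
    (hℓ : ∀ j, 2 ≤ j → ℓ j = ⌈((d : ℝ) + 1) ^ 2 / ((s : ℝ) - 1)⌉₊) :
    ∀ j, dims d (fun _ => d + 1) (j + 1) * dims d (fun _ => d + 1) j ≤ ℓ (j + 1) * (s - 1)
  | 0 => by
    have := le_natCeil_div_mul_sub_one hs (d * (d + 1))
    push_cast at this
    simpa only [dims, zero_add, hℓ₁, mul_comm] using this
  | j + 1 => by
    have := le_natCeil_div_mul_sub_one hs ((d + 1) ^ 2)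
    push_cast at this
    rwa [hℓ _ (by omega), dims, dims, ← sq]

end EDCNN

theorem corollary5_general {d s : ℕ} (hd : 0 < d) {dstar ℓ : ℕ → ℕ}
    (hdstar : ∀ j, d < dstar (j + 1))
    (hℓ : ∀ j, EDCNN.dims d dstar (j + 1) * EDCNN.dims d dstar j ≤ ℓ (j + 1) * (s - 1))
    {ε : ℝ} (hε : 0 < ε) (f : C(EDCNN.Cube d, ℝ)) :
    ∃ L : ℕ, 1 ≤ L ∧ (EDCNN.networks s d dstar ℓ L).Nonempty ∧
      Metric.infDist f (EDCNN.networks s d dstar ℓ L) < ε := by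
  obtain ⟨F, rfl⟩ := ContinuousMap.exists_restrict_eq isClosed_Icc f
  obtain ⟨g, hg, hgF⟩ := EDCNN.exists_isMaxMinString_abs_sub_le
    (isCompact_Icc (a := (0 : Fin d → ℝ)) (b := 1)) F.continuous.continuousOn (half_pos hε)
  obtain ⟨L, hL, hgL⟩ := hg.exists_mem_networks hd hdstar hℓ
  refine ⟨L, hL, ⟨_, hgL⟩, (Metric.infDist_le_dist_of_mem hgL).trans_lt
    (lt_of_le_of_lt ?_ (half_lt_self hε))⟩
  rw [dist_comm]
  exact (ContinuousMap.dist_le (half_pos hε).le).2 fun x => hgF x x.2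

theorem corollary5 (d s : ℕ) (hs : 2 ≤ s) (hsd : s ≤ d)
    (ℓ : ℕ → ℕ)
    (hℓ₁ : ℓ 1 = ⌈(d : ℝ) * ((d : ℝ) + 1) / ((s : ℝ) - 1)⌉₊)
    (hℓ : ∀ j, 2 ≤ j → ℓ j = ⌈((d : ℝ) + 1) ^ 2 / ((s : ℝ) - 1)⌉₊)
    (ε : ℝ) (hε : 0 < ε) (f : C(EDCNN.Cube d, ℝ)) :
    ∃ L : ℕ, 1 ≤ L ∧
      (EDCNN.networks s d (fun _ => d + 1) ℓ L).Nonempty ∧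
      Metric.infDist f (EDCNN.networks s d (fun _ => d + 1) ℓ L) < ε :=
  corollary5_general (by omega) (fun _ => d.lt_succ_self) (EDCNN.dims_mul_dims_le hs hℓ₁ hℓ) hε f
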